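/- **Proposition 4.3.** Let $p$ be a prime, $n\in\mathbb N$, and regard $\mathbb Q_p^n$ as an additive topological group. Let $\mathrm{Sub}_{\mathbb Q_p^n}$ be the set of closed subgroups of $\mathbb Q_p^n$ with the Chabauty topology, i.e. the topology with sub-basis the sets $\{H : H\cap K=\emptyset\}$ ($K$ compact) and $\{H : H\cap U\neq\emptyset\}$ ($U$ open); this space is metrizable. Fix any metric $\mathbf d$ on $\mathrm{Sub}_{\mathbb Q_p^n}$ inducing this topology. For an automorphism $T$ of the topological group $\mathbb Q_p^n$, say that $T$ *acts expansively* on $\mathrm{Sub}_{\mathbb Q_p^n}$ if there is $\delta>0$ such that for all $H\neq H'$ in $\mathrm{Sub}_{\mathbb Q_p^n}$ there is $k\in\mathbb Z$ with $\mathbf d(T^k(H),T^k(H'))>\delta$, and that $T$ *is expansive* if $\bigcap_{k\in\mathbb Z}T^k(U)=\{0\}$ for some neighbourhood $U$ of $0$ in $\mathbb Q_p^n$. 1. If $n=1$ and $T\in\mathrm{GL}(1,\mathbb Q_p)$, then $T$ acts expansively on $\mathrm{Sub}_{\mathbb Q_p}$ if and only if $T$ is expansive; and $T$ is expansive if and only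 if $T$ is multiplication by $p^m z$ for some $m\in\mathbb Z\setminus\{0\}$ and some unit $z\in\mathbb Z_p^{*}$. 2. If $n\ge 2$, then no $T\in\mathrm{GL}(n,\mathbb Q_p)$ acts expansively on $\mathrm{Sub}_{\mathbb Q_p^n}$. That is, no automorphism of the topological group $\mathbb Q_p^n$ acts expansively on $\mathrm{Sub}_{\mathbb Q_p^n}$. -/

import Mathlib

open Topology

/-- The Chabauty topology on the set `Sub_G` of closed subgroups of an additively written
topological group `G`. A sub-basis consists of the sets `{H | H ∩ K = ∅}` with `K` compact and
`{H | H ∩ U ≠ ∅}` with `U` open. -/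
instance chabautyTopology (G : Type*) [AddGroup G] [TopologicalSpace G] :
    TopologicalSpace (ClosedAddSubgroup G) :=
  TopologicalSpace.generateFrom
    ({O | ∃ K : Set G, IsCompact K ∧ O = {H : ClosedAddSubgroup G | (H : Set G) ∩ K = ∅}} ∪
     {O | ∃ U : Set G, IsOpen U ∧ O = {H : ClosedAddSubgroup G | ((H : Set G) ∩ U).Nonempty}})

namespace ClosedAddSubgroup

/-- The image `T(H)` of a closed subgroup `H` under an automorphism `T` of the topological
group `G`. -/
def image {G : Type*} [AddGroup G] [TopologicalSpace G] (T : G ≃ₜ+ G)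
    (H : ClosedAddSubgroup G) : ClosedAddSubgroup G where
  toAddSubgroup := H.toAddSubgroup.map (T : G ≃+ G).toAddMonoidHom
  isClosed' := T.toHomeomorph.isClosedMap _ H.isClosed'

theorem coe_image {G : Type*} [AddGroup G] [TopologicalSpace G] (T : G ≃ₜ+ G)
    (H : ClosedAddSubgroup G) : (image T H : Set G) = T '' (H : Set G) := rfl

theorem continuous_image {G : Type*} [AddGroup G] [TopologicalSpace G] (T : G ≃ₜ+ G) :
    Continuous (image T) := by
  refine continuous_generateFrom_iff.2 ?_
  rintro O (⟨K, hK, rfl⟩ | ⟨U, hU, rfl⟩)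
  · refine TopologicalSpace.isOpen_generateFrom_of_mem (Or.inl ⟨T ⁻¹' K, ?_, ?_⟩)
    · exact T.toHomeomorph.isCompact_preimage.2 hK
    · ext H
      simp only [Set.mem_preimage, Set.mem_ofPred_eq, coe_image, ← Set.not_nonempty_iff_eq_empty,
        Set.image_inter_nonempty_iff]
  · refine TopologicalSpace.isOpen_generateFrom_of_mem (Or.inr ⟨T ⁻¹' U, ?_, ?_⟩)
    · exact hU.preimage T.toHomeomorph.continuous
    · ext H
      simp only [Set.mem_preimage, Set.mem_ofPred_eq, coe_image, Set.image_inter_nonempty_iff]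

/-- The action of an automorphism `T` of the topological group `G` on `Sub_G`: the homeomorphism
`H ↦ T(H)`. -/
def actionHomeomorph {G : Type*} [AddGroup G] [TopologicalSpace G] (T : G ≃ₜ+ G) :
    ClosedAddSubgroup G ≃ₜ ClosedAddSubgroup G where
  toFun := image T
  invFun := image T.symm
  left_inv H := SetLike.coe_injective (by
    rw [coe_image, coe_image, ← Set.image_comp]
    simp)
  right_inv H := SetLike.coe_injective (by
    rw [coe_image, coe_image, ← Set.image_comp]
    simp)
  continuous_toFun := continuous_image T
  continuous_invFun := continuous_image T.symm

/-- The Chabauty space of a second countable, totally disconnected locally compact group is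
metrizable: a closed subgroup is determined by the members of a countable basis of compact open
sets that it meets. -/
theorem metrizableSpace (G : Type*) [AddGroup G] [TopologicalSpace G] [SecondCountableTopology G]
    [T2Space G] [LocallyCompactSpace G] [TotallyDisconnectedSpace G] :
    TopologicalSpace.MetrizableSpace (ClosedAddSubgroup G) := by
  have hb : TopologicalSpace.IsTopologicalBasis {s : Set G | IsOpen s ∧ IsCompact s} := by
    refine TopologicalSpace.isTopologicalBasis_of_isOpen_of_nhds (fun s hs => hs.1) ?_
    intro a U ha hU
    obtain ⟨K, hK, haK, hKU⟩ := exists_compact_subset hU ha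
    obtain ⟨V, hV, haV, hVK⟩ := loc_compact_Haus_tot_disc_of_zero_dim.exists_subset_of_mem_open
      haK isOpen_interior
    exact ⟨V, ⟨hV.isOpen, hK.of_isClosed_subset hV.isClosed (hVK.trans interior_subset)⟩, haV,
      (hVK.trans interior_subset).trans hKU⟩
  obtain ⟨B, hBsub, hBc, hB⟩ := hb.exists_countable
  have : Countable B := hBc.to_subtype
  classical
  let f : ClosedAddSubgroup G → (B → Bool) := fun H b => decide ((H : Set G) ∩ b).Nonempty
  have hpre (b : B) : IsOpen[TopologicalSpace.induced f inferInstance]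
        {H : ClosedAddSubgroup G | ((H : Set G) ∩ b).Nonempty} ∧
      IsOpen[TopologicalSpace.induced f inferInstance]
        {H : ClosedAddSubgroup G | (H : Set G) ∩ b = ∅} := by
    constructor
    · refine ⟨(fun g => g b) ⁻¹' {true}, (isOpen_discrete _).preimage (continuous_apply b), ?_⟩
      ext H; simp [f]
    · refine ⟨(fun g => g b) ⁻¹' {false}, (isOpen_discrete _).preimage (continuous_apply b), ?_⟩
      ext H; simp [f, Set.not_nonempty_iff_eq_empty]
  have hind : IsInducing f := by
    refine ⟨le_antisymm ?_ ?_⟩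
    · rw [← continuous_iff_le_induced]
      refine continuous_pi fun b => ?_
      rw [continuous_discrete_rng]
      rintro (_ | _)
      · refine TopologicalSpace.isOpen_generateFrom_of_mem (Or.inl ⟨b, (hBsub b.2).2, ?_⟩)
        ext H; simp [f, Set.not_nonempty_iff_eq_empty]
      · refine TopologicalSpace.isOpen_generateFrom_of_mem (Or.inr ⟨b, (hBsub b.2).1, ?_⟩)
        ext H; simp [f]
    · refine le_generateFrom ?_
      rintro O (⟨K, hK, rfl⟩ | ⟨U, hU, rfl⟩)
      · rw [@isOpen_iff_forall_mem_open _ (TopologicalSpace.induced f inferInstance) _]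
        intro H hH
        have hcov : ∀ x ∈ K, ∃ b : Set G, b ∈ B ∧ x ∈ b ∧ b ⊆ (H : Set G)ᶜ := by
          intro x hx
          have hxH : x ∈ (H : Set G)ᶜ := fun h => by
            have : x ∈ (H : Set G) ∩ K := ⟨h, hx⟩
            rw [hH] at this
            exact this
          obtain ⟨b, hbB, hxb, hbH⟩ := hB.exists_subset_of_mem_open hxH H.isClosed'.isOpen_compl
          exact ⟨b, hbB, hxb, hbH⟩
        choose! b hb0 hb1 hb2 using hcov
        obtain ⟨t, htK, ht⟩ := hK.elim_nhds_subcover b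
          (fun x hx => (hBsub (hb0 x hx)).1.mem_nhds (hb1 x hx))
        refine ⟨⋂ x ∈ t, {H : ClosedAddSubgroup G | (H : Set G) ∩ b x = ∅}, ?_, ?_, ?_⟩
        · intro H' hH'
          simp only [Set.mem_iInter, Set.mem_ofPred_eq] at hH' ⊢
          refine Set.eq_empty_of_forall_notMem fun y hy => ?_
          obtain ⟨x, hx, hyx⟩ := Set.mem_iUnion₂.1 (ht hy.2)
          have : y ∈ (H' : Set G) ∩ b x := ⟨hy.1, hyx⟩
          rw [hH' x hx] at this
          exact this
        · exact @isOpen_biInter_finset _ _ (TopologicalSpace.induced f inferInstance) _ _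
            (fun x hx => (hpre ⟨b x, hb0 x (htK x hx)⟩).2)
        · simp only [Set.mem_iInter, Set.mem_ofPred_eq]
          intro x hx
          exact Set.eq_empty_of_forall_notMem fun y hy => hb2 x (htK x hx) hy.2 hy.1
      · rw [@isOpen_iff_forall_mem_open _ (TopologicalSpace.induced f inferInstance) _]
        rintro H ⟨x, hxH, hxU⟩
        obtain ⟨b, hbB, hxb, hbU⟩ := hB.exists_subset_of_mem_open hxU hU
        exact ⟨_, fun H' hH' => hH'.mono (Set.inter_subset_inter_right _ hbU),
          (hpre ⟨b, hbB⟩).1, ⟨x, hxH, hxb⟩⟩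
  have hinj : Function.Injective f := by
    have key : ∀ H H' : ClosedAddSubgroup G, f H = f H' → (H : Set G) ⊆ H' := by
      intro H H' h x hx
      by_contra hx'
      obtain ⟨b, hbB, hxb, hbH⟩ := hB.exists_subset_of_mem_open
        (show x ∈ (H' : Set G)ᶜ from hx') H'.isClosed'.isOpen_compl
      have h1 := congrFun h ⟨b, hbB⟩
      simp only [f, decide_eq_decide] at h1
      obtain ⟨y, hy, hyb⟩ := h1.1 ⟨x, hx, hxb⟩
      exact hbH hyb hy
    exact fun H H' h => SetLike.coe_injective
      (Set.Subset.antisymm (key H H' h) (key H' H h.symm))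
  exact (IsEmbedding.mk hind hinj).metrizableSpace

/-- In particular `Sub_{ℚ_p^n}` is metrizable, so compatible metrics on it exist. -/
instance (p : ℕ) [Fact p.Prime] (n : ℕ) :
    TopologicalSpace.MetrizableSpace (ClosedAddSubgroup (Fin n → ℚ_[p])) :=
  metrizableSpace _

end ClosedAddSubgroup

/-- A homeomorphism `φ` of a topological space `X` is expansive with respect to the metric `d`
on `X` if there is `δ > 0` such that for all `x ≠ y` there is an integer `k` with
`d (φ^k x, φ^k y) > δ`. -/
def IsExpansiveHomeomorph {X : Type*} [TopologicalSpace X] (d : MetricSpace X) (φ : X ≃ₜ X) :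
    Prop :=
  ∃ δ : ℝ, 0 < δ ∧ ∀ x y : X, x ≠ y → ∃ k : ℤ, δ < d.dist ((φ ^ k) x) ((φ ^ k) y)

/-- An automorphism `T` of a topological group `G` is expansive if `⋂_{k ∈ ℤ} T^k(U) = {0}` for
some neighbourhood `U` of the identity. -/
def IsExpansiveAut {G : Type*} [AddGroup G] [TopologicalSpace G] (T : G ≃ₜ+ G) : Prop :=
  ∃ U ∈ 𝓝 (0 : G), ⋂ k : ℤ, (T.toHomeomorph ^ k) '' U = {0}

/-- The automorphism `x ↦ T x` of the topological group `R^n` given by an invertible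
matrix `T`. -/
def Matrix.GeneralLinearGroup.toAut {n : ℕ} {R : Type*} [CommRing R] [TopologicalSpace R]
    [IsTopologicalRing R] (T : GL (Fin n) R) : (Fin n → R) ≃ₜ+ (Fin n → R) where
  toFun x := T.1.mulVec x
  invFun x := T⁻¹.1.mulVec x
  left_inv x := by
    change (T⁻¹.1).mulVec (T.1.mulVec x) = x
    rw [Matrix.mulVec_mulVec, ← Units.val_mul, inv_mul_cancel, Units.val_one, Matrix.one_mulVec]
  right_inv x := by
    change T.1.mulVec ((T⁻¹.1).mulVec x) = x
    rw [Matrix.mulVec_mulVec, ← Units.val_mul, mul_inv_cancel, Units.val_one, Matrix.one_mulVec]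
  map_add' x y := Matrix.mulVec_add _ x y
  continuous_toFun := Continuous.matrix_mulVec continuous_const continuous_id
  continuous_invFun := Continuous.matrix_mulVec continuous_const continuous_id

/-! In dimension one, closed subgroups are `ℤ_p`-submodules, hence `{0}`, the balls, or the whole
space, and the balls of positive radius are isolated points of the Chabauty space
(`isOpen_singleton_normBall`). Let `T` be multiplication by `a`. If `‖a‖ = 1`, every ball is fixed
while small balls converge to `{0}`, so no `δ` works. If `‖a‖ ≠ 1`, the balls of positive radius
form finitely many orbits of isolated points; the one pair without such a ball, `{0}` and the whole
space, is separated at time `0`. Expansivity of `T` on the group is equivalent to `‖a‖ ≠ 1` too.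

In dimension at least two, lines already defeat expansivity. The line through `x` depends
continuously on `x ≠ 0`, hence uniformly on shells. If `w` is not on the line of `v` and `‖L^k w‖ ≤
M ‖L^k v‖` for all `k`, then the lines of `v` and `v + c • w`, with `c` small, stay close under
every iterate (`not_isExpansiveHomeomorph_of_norm_zpow_le`). Such a pair always exists: `w = L v` if
`v` is not an eigenvector, and any independent pair if `L` is scalar. -/

open Filter

/-! ### Expansivity with respect to a compatible metric -/

section Expansive

variable {X : Type*} [t : TopologicalSpace X] (d : MetricSpace X)

theorem eventually_dist_lt_of_compatible (hd : d.toUniformSpace.toTopologicalSpace = t)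
    (x : X) {ε : ℝ} (hε : 0 < ε) : ∀ᶠ y in 𝓝 x, d.dist x y < ε := by
  subst hd
  filter_upwards [Metric.ball_mem_nhds x hε] with y hy
  rwa [Metric.mem_ball, dist_comm] at hy

theorem exists_dist_lt_of_isCompact_of_continuousOn
    (hd : d.toUniformSpace.toTopologicalSpace = t) {Y : Type*} [PseudoMetricSpace Y] {C : Set Y}
    (hC : IsCompact C) {F : Y → X} (hF : ContinuousOn F C) {ε : ℝ} (hε : 0 < ε) :
    ∃ η > 0, ∀ x ∈ C, ∀ y ∈ C, dist x y < η → d.dist (F x) (F y) < ε := by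
  subst hd
  exact Metric.uniformContinuousOn_iff.1 (hC.uniformContinuousOn_of_continuous hF) ε hε

/-- Each isolated point `f i` is at a positive distance from all other points, and finiteness of `s`
makes the bound common. When an iterate of one point lands on `f i`, the same iterate of the other
differs from it by injectivity. -/
theorem IsExpansiveHomeomorph.of_isOpen_singletons
    (hd : d.toUniformSpace.toTopologicalSpace = t) (φ : X ≃ₜ X) {ι : Type*} (s : Finset ι)
    (f : ι → X) (hf : ∀ i ∈ s, IsOpen {f i}) (x₀ y₀ : X) (h₀ : x₀ ≠ y₀)
    (h : ∀ x y : X, x ≠ y → (∃ k : ℤ, ∃ i ∈ s, (φ ^ k) x = f i ∨ (φ ^ k) y = f i) ∨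
      (x = x₀ ∧ y = y₀) ∨ (x = y₀ ∧ y = x₀)) :
    IsExpansiveHomeomorph d φ := by
  subst hd
  have hev : ∀ i ∈ s, ∀ᶠ δ in 𝓝[>] (0 : ℝ), ∀ z, z ≠ f i → δ < dist z (f i) := by
    intro i hi
    obtain ⟨ε, hε, hb⟩ := Metric.isOpen_iff.1 (hf i hi) _ rfl
    filter_upwards [Ioo_mem_nhdsGT hε] with δ hδ z hz
    by_contra! hlt
    exact hz (hb (Metric.mem_ball.2 (hlt.trans_lt hδ.2)))
  obtain ⟨δ, ⟨hδ, hδ₀⟩, hδ1⟩ := (((eventually_all_finset s).2 hev).and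
    (Ioo_mem_nhdsGT (dist_pos.2 h₀))).and self_mem_nhdsWithin |>.exists
  refine ⟨δ, hδ1, fun x y hxy => ?_⟩
  obtain ⟨k, i, hi, hk⟩ | ⟨rfl, rfl⟩ | ⟨rfl, rfl⟩ := h x y hxy
  · refine ⟨k, ?_⟩
    have hne : (φ ^ k) x ≠ (φ ^ k) y := (φ ^ k).injective.ne hxy
    rcases hk with hk | hk
    · rw [hk] at hne ⊢
      exact (hδ i hi _ hne.symm).trans_eq (dist_comm _ _)
    · rw [hk] at hne ⊢
      exact hδ i hi _ hne
  · exact ⟨0, hδ₀.2⟩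
  · exact ⟨0, hδ₀.2.trans_eq (dist_comm _ _)⟩

end Expansive

/-! ### Iterates of an automorphism -/

namespace ClosedAddSubgroup

theorem coe_actionHomeomorph_zpow {G : Type*} [AddGroup G] [TopologicalSpace G] (T : G ≃ₜ+ G)
    (k : ℤ) (H : ClosedAddSubgroup G) :
    (((actionHomeomorph T) ^ k) H : Set G) = (T.toHomeomorph ^ k) '' (H : Set G) := by
  have h1 (H : ClosedAddSubgroup G) :
      ((actionHomeomorph T) H : Set G) = T.toHomeomorph '' (H : Set G) := rfl
  have h2 (H : ClosedAddSubgroup G) :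
      ((actionHomeomorph T)⁻¹ H : Set G) = (T.toHomeomorph⁻¹ : G ≃ₜ G) '' (H : Set G) := rfl
  induction k generalizing H with
  | zero => exact (Set.image_id _).symm
  | succ k ih =>
    rw [zpow_add_one, zpow_add_one, Homeomorph.mul_apply, ih, h1, ← Set.image_comp]
    rfl
  | pred k ih =>
    rw [zpow_sub_one, zpow_sub_one, Homeomorph.mul_apply, ih, h2, ← Set.image_comp]
    rfl

theorem toHomeomorph_zpow_apply {𝕜 E : Type*} [Semiring 𝕜] [AddCommGroup E]
    [TopologicalSpace E] [Module 𝕜 E] {T : E ≃ₜ+ E} {L : E ≃L[𝕜] E}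
    (hL : ∀ x, L x = T x) (k : ℤ) (x : E) : (T.toHomeomorph ^ k) x = (L ^ k) x := by
  induction k generalizing x with
  | zero => rfl
  | succ k ih =>
    rw [zpow_add_one, zpow_add_one, Homeomorph.mul_apply, ih]
    exact congrArg _ (hL x).symm
  | pred k ih =>
    rw [zpow_sub_one, zpow_sub_one, Homeomorph.mul_apply, ih]
    refine congrArg (⇑(L ^ (-(k : ℤ)))) (L.injective ?_)
    exact ((hL _).trans (T.apply_symm_apply x)).trans (L.apply_symm_apply x).symm

theorem toHomeomorph_zpow_apply_of_smul {𝕜 E : Type*} [DivisionRing 𝕜] [AddCommGroup E]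
    [TopologicalSpace E] [Module 𝕜 E] {T : E ≃ₜ+ E} {a : 𝕜} (ha : a ≠ 0)
    (hT : ∀ x, T x = a • x) (k : ℤ) (x : E) : (T.toHomeomorph ^ k) x = a ^ k • x := by
  induction k generalizing x with
  | zero => exact (by simp : x = a ^ (0 : ℤ) • x)
  | succ k ih =>
    rw [zpow_add_one, zpow_add_one₀ ha, Homeomorph.mul_apply, ih, mul_smul]
    exact congrArg _ (hT x)
  | pred k ih =>
    rw [zpow_sub_one, zpow_sub_one₀ ha, Homeomorph.mul_apply, ih, mul_smul]
    refine congrArg _ (T.injective ?_)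
    rw [hT (a⁻¹ • x), smul_inv_smul₀ ha]
    exact T.apply_symm_apply x

/-! ### Lines, and non-expansivity in dimension at least two -/

section Line

variable {𝕜 E : Type*} [NontriviallyNormedField 𝕜] [ProperSpace 𝕜] [NormedAddCommGroup E]
  [NormedSpace 𝕜 E]

variable (𝕜) in
/-- The line spanned by a vector, as a closed subgroup. -/
def line (x : E) : ClosedAddSubgroup E where
  toAddSubgroup := (Submodule.span 𝕜 {x}).toAddSubgroup
  isClosed' := Submodule.closed_of_finiteDimensional (Submodule.span 𝕜 {x})

theorem mem_line {x y : E} : y ∈ line 𝕜 x ↔ ∃ c : 𝕜, c • x = y :=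
  Submodule.mem_span_singleton

theorem line_smul {c : 𝕜} (hc : c ≠ 0) (x : E) : line 𝕜 (c • x) = line 𝕜 x := by
  refine SetLike.ext fun y => ?_
  rw [mem_line, mem_line]
  constructor
  · rintro ⟨a, rfl⟩
    exact ⟨a * c, mul_smul _ _ _⟩
  · rintro ⟨a, rfl⟩
    exact ⟨a * c⁻¹, by rw [smul_smul, inv_mul_cancel_right₀ hc]⟩

/-- To avoid a compact set, only scalars in a fixed closed ball matter once `y` is near `x ≠ 0`, and
that ball is compact, so finitely many conditions on `y` suffice. To meet an open set, the same
scalar serves for nearby `y`. -/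
theorem continuousAt_line {x : E} (hx : x ≠ 0) : ContinuousAt (line 𝕜 : E → _) x := by
  refine TopologicalSpace.tendsto_nhds_generateFrom_iff.2 ?_
  rintro O (⟨K, hK, rfl⟩ | ⟨U, hU, rfl⟩) hO
  · obtain ⟨R, hR⟩ := hK.isBounded.exists_norm_le
    have hx0 : 0 < ‖x‖ := norm_pos_iff.2 hx
    have hnear : ∀ᶠ y in 𝓝 x, ‖x‖ / 2 < ‖y‖ :=
      continuous_norm.continuousAt.eventually_const_lt (by linarith)
    have hc : ∀ c ∈ Metric.closedBall (0 : 𝕜) (R / (‖x‖ / 2)), ∀ᶠ q : E × 𝕜 in 𝓝 (x, c),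
        q.2 • q.1 ∈ Kᶜ := by
      intro c _
      have hcont : Continuous fun q : E × 𝕜 => q.2 • q.1 := by fun_prop
      refine hcont.continuousAt.eventually_mem (hK.isClosed.isOpen_compl.mem_nhds fun hmem => ?_)
      exact Set.eq_empty_iff_forall_notMem.1 hO _ ⟨mem_line.2 ⟨c, rfl⟩, hmem⟩
    filter_upwards [hnear, IsCompact.eventually_forall_of_forall_eventually
      (P := fun (y : E) (c : 𝕜) => c • y ∈ Kᶜ) (isCompact_closedBall _ _) hc]
      with y hy hyc
    refine Set.eq_empty_of_forall_notMem ?_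
    rintro z ⟨hz, hzK⟩
    obtain ⟨c, rfl⟩ := mem_line.1 hz
    refine hyc c ?_ hzK
    rw [mem_closedBall_zero_iff, le_div_iff₀ (by linarith)]
    have := hR _ hzK
    rw [norm_smul] at this
    exact (mul_le_mul_of_nonneg_left hy.le (norm_nonneg c)).trans this
  · obtain ⟨z, hz, hzU⟩ := hO
    obtain ⟨c, rfl⟩ := mem_line.1 hz
    filter_upwards [(continuous_const_smul c).continuousAt.eventually_mem (hU.mem_nhds hzU)]
      with y hy
    exact ⟨_, mem_line.2 ⟨c, rfl⟩, hy⟩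

theorem actionHomeomorph_zpow_line {T : E ≃ₜ+ E} {L : E ≃L[𝕜] E}
    (hL : ∀ x, L x = T x) (k : ℤ) (x : E) :
    (actionHomeomorph T ^ k) (line 𝕜 x) = line 𝕜 ((L ^ k) x) := by
  have hk := toHomeomorph_zpow_apply hL
  refine SetLike.coe_injective ?_
  rw [coe_actionHomeomorph_zpow]
  ext z
  simp only [Set.mem_image, SetLike.mem_coe, mem_line]
  constructor
  · rintro ⟨_, ⟨c, rfl⟩, rfl⟩
    exact ⟨c, by rw [hk, map_smul]⟩
  · rintro ⟨c, rfl⟩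
    exact ⟨_, ⟨c, rfl⟩, by rw [hk, map_smul]⟩

variable [FiniteDimensional 𝕜 E]

theorem exists_dist_line_lt (d : MetricSpace (ClosedAddSubgroup E))
    (hd : d.toUniformSpace.toTopologicalSpace = chabautyTopology E) {r R ε : ℝ} (hr : 0 < r)
    (hε : 0 < ε) : ∃ η > 0, ∀ x y : E, r ≤ ‖x‖ → ‖x‖ ≤ R → r ≤ ‖y‖ → ‖y‖ ≤ R → ‖x - y‖ < η →
      d.dist (line 𝕜 x) (line 𝕜 y) < ε := by
  have : ProperSpace E := FiniteDimensional.proper 𝕜 E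
  have hC : IsCompact {x : E | r ≤ ‖x‖ ∧ ‖x‖ ≤ R} := by
    refine (isCompact_closedBall (0 : E) R).of_isClosed_subset ?_ fun x hx => by simpa using hx.2
    exact (isClosed_le continuous_const continuous_norm).inter
      (isClosed_le continuous_norm continuous_const)
  have hF : ContinuousOn (line 𝕜 : E → _) {x : E | r ≤ ‖x‖ ∧ ‖x‖ ≤ R} := fun x hx =>
    (continuousAt_line (norm_pos_iff.1 (hr.trans_le hx.1))).continuousWithinAt
  obtain ⟨η, hη, h⟩ := exists_dist_lt_of_isCompact_of_continuousOn d hd hC hF hε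
  exact ⟨η, hη, fun x y hx hx' hy hy' hxy => h x ⟨hx, hx'⟩ y ⟨hy, hy'⟩ (by rwa [dist_eq_norm])⟩

/-- Rescaling does not change a line, so at each time `k` both vectors can be moved by a common
scalar into one shell. There the bound `M` makes their difference at most `‖c‖ * |M|`, uniformly in
`k`. -/
theorem not_isExpansiveHomeomorph_of_norm_zpow_le (d : MetricSpace (ClosedAddSubgroup E))
    (hd : d.toUniformSpace.toTopologicalSpace = chabautyTopology E) {T : E ≃ₜ+ E}
    {L : E ≃L[𝕜] E} (hL : ∀ x, L x = T x) {v w : E} (hv : v ≠ 0)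
    (hw : ∀ c : 𝕜, c • v ≠ w) (M : ℝ)
    (hM : ∀ k : ℤ, ‖(L ^ k) w‖ ≤ M * ‖(L ^ k) v‖) :
    ¬ IsExpansiveHomeomorph d (actionHomeomorph T) := by
  rintro ⟨δ, hδ, h⟩
  obtain ⟨a, ha⟩ := NormedField.exists_one_lt_norm 𝕜
  have ha0 : 0 < ‖a‖ := one_pos.trans ha
  -- Powers of `a` bring any nonzero vector to norm in `[r, 1)`; a perturbation of size below `r /
  -- 2` then stays in the shell `[r / 2, 2]`.
  set r : ℝ := 1 / ‖a‖ with hr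
  have hr0 : 0 < r := by positivity
  have hr1 : r < 1 := by rwa [hr, div_lt_one ha0]
  obtain ⟨η, hη, hline⟩ := exists_dist_line_lt (𝕜 := 𝕜) d hd (r := r / 2) (R := 2)
    (by positivity) hδ
  obtain ⟨c, hc0, hc⟩ := NormedField.exists_norm_lt 𝕜
    (show 0 < min η (r / 2) / (|M| + 1) by positivity)
  have hc0' : c ≠ 0 := norm_pos_iff.1 hc0
  have hcM : ‖c‖ * |M| < min η (r / 2) := by
    rw [lt_div_iff₀ (by positivity)] at hc
    nlinarith
  have hne : line 𝕜 v ≠ line 𝕜 (v + c • w) := by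
    intro heq
    have hmem : v + c • w ∈ line 𝕜 v := by
      rw [heq]
      exact mem_line.2 ⟨1, one_smul _ _⟩
    obtain ⟨b, hb⟩ := mem_line.1 hmem
    refine hw (c⁻¹ * (b - 1)) ?_
    rw [mul_smul, sub_smul, one_smul, hb, add_sub_cancel_left, smul_smul, inv_mul_cancel₀ hc0',
      one_smul]
  obtain ⟨k, hk⟩ := h _ _ hne
  refine hk.not_ge (le_of_lt ?_)
  rw [actionHomeomorph_zpow_line hL, actionHomeomorph_zpow_line hL]
  have hLv : (L ^ k) v ≠ 0 := fun h0 => hv ((L ^ k).map_eq_zero_iff.1 h0)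
  obtain ⟨b, hb0, hb1, hb2, -⟩ := rescale_to_shell ha one_pos hLv
  rw [← line_smul hb0, ← line_smul hb0 ((L ^ k) (v + c • w))]
  have hdiff : ‖b • (L ^ k) v - b • (L ^ k) (v + c • w)‖ < min η (r / 2) := by
    rw [map_add, map_smul, smul_add, sub_add_cancel_left, norm_neg, smul_comm, norm_smul]
    refine lt_of_le_of_lt (mul_le_mul_of_nonneg_left ?_ (norm_nonneg c)) hcM
    calc ‖b • (L ^ k) w‖ ≤ |M| * ‖b • (L ^ k) v‖ := by
          rw [norm_smul, norm_smul]
          have := (hM k).trans (mul_le_mul_of_nonneg_right (le_abs_self M) (norm_nonneg _))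
          nlinarith [mul_le_mul_of_nonneg_left this (norm_nonneg b)]
      _ ≤ |M| := mul_le_of_le_one_right (abs_nonneg M) hb1.le
  have h1 := hdiff.trans_le (min_le_right _ _)
  have h2 := (abs_norm_sub_norm_le _ _).trans_lt h1
  rw [abs_lt] at h2
  refine hline _ _ ?_ ?_ ?_ ?_ (hdiff.trans_le (min_le_left _ _)) <;> linarith [h2.1, h2.2]

theorem not_isExpansiveHomeomorph_of_one_lt_finrank (d : MetricSpace (ClosedAddSubgroup E))
    (hd : d.toUniformSpace.toTopologicalSpace = chabautyTopology E)
    (hE : 1 < Module.finrank 𝕜 E) {T : E ≃ₜ+ E} {L : E ≃L[𝕜] E} (hL : ∀ x, L x = T x) :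
    ¬ IsExpansiveHomeomorph d (actionHomeomorph T) := by
  by_cases hv : ∃ v : E, ∀ c : 𝕜, c • v ≠ L v
  · obtain ⟨v, hv⟩ := hv
    have hv0 : v ≠ 0 := by
      rintro rfl
      exact hv 0 (by simp)
    -- Take `w = L v`: since `L` commutes with its powers, the operator norm of `L` serves as `M`.
    refine not_isExpansiveHomeomorph_of_norm_zpow_le d hd hL hv0 hv ‖(L : E →L[𝕜] E)‖ fun k => ?_
    have : (L ^ k) (L v) = L ((L ^ k) v) :=
      DFunLike.congr_fun ((Commute.refl L).zpow_left k).eq v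
    rw [this]
    exact (L : E →L[𝕜] E).le_opNorm _
  · push Not at hv
    have : Nontrivial E := Module.nontrivial_of_finrank_pos (R := 𝕜) (by lia)
    obtain ⟨v, hv0⟩ := exists_ne (0 : E)
    have hw : ∃ w : E, ∀ c : 𝕜, c • v ≠ w := by
      by_contra! hw
      have := finrank_le_one v hw
      lia
    obtain ⟨w, hw⟩ := hw
    -- Every vector is now an eigenvector, which forces a single eigenvalue.
    obtain ⟨a, ha⟩ : ∃ a : 𝕜, (L : E →ₗ[𝕜] E) = a • LinearMap.id := by
      refine LinearMap.exists_eq_smul_id_of_forall_notLinearIndependent fun x hx => ?_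
      obtain ⟨c, hc⟩ := hv x
      rw [LinearIndependent.pair_iff] at hx
      simpa using (hx c (-1) (by simp [hc])).2
    have hLa : ∀ x, L x = a • x := fun x => LinearMap.congr_fun ha x
    have ha0 : a ≠ 0 := by
      rintro rfl
      exact hv0 (L.map_eq_zero_iff.1 (by rw [hLa, zero_smul]))
    have hLk (k : ℤ) (x : E) : (L ^ k) x = a ^ k • x := by
      rw [← toHomeomorph_zpow_apply hL,
        toHomeomorph_zpow_apply_of_smul ha0 fun x => (hL x).symm.trans (hLa x)]
    refine not_isExpansiveHomeomorph_of_norm_zpow_le d hd hL hv0 hw (‖w‖ / ‖v‖) fun k => ?_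
    rw [hLk, hLk, norm_smul, norm_smul, mul_left_comm, div_mul_cancel₀ _ (norm_ne_zero_iff.2 hv0)]

end Line

end ClosedAddSubgroup

/-- An automorphism of the topological group underlying a `ℚ_p`-vector space is linear. -/
theorem ContinuousAddEquiv.map_padic_smul {p : ℕ} [Fact p.Prime] {E : Type*}
    [NormedAddCommGroup E] [NormedSpace ℚ_[p] E] (T : E ≃ₜ+ E) (c : ℚ_[p]) (x : E) :
    T (c • x) = c • T x := by
  have hT := T.continuous
  -- Additivity gives the identity for rational scalars; density and continuity extend it.
  refine congrFun ((Padic.denseRange_ratCast p).equalizer (f := (Rat.cast : ℚ → ℚ_[p]))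
    (g := fun c : ℚ_[p] => T (c • x)) (h := fun c => c • T x) (by fun_prop) (by fun_prop)
    (funext fun q => ?_)) c
  exact map_ratCast_smul (T : E ≃+ E) ℚ_[p] ℚ_[p] q x

/-! ### Closed subgroups of a one-dimensional `ℚ_p`-space -/

namespace ClosedAddSubgroup

variable {p : ℕ} [Fact p.Prime] {E : Type*} [NormedAddCommGroup E] [NormedSpace ℚ_[p] E]

theorem padicInt_smul_mem (H : ClosedAddSubgroup E) (c : ℤ_[p]) {x : E} (hx : x ∈ H) :
    (c : ℚ_[p]) • x ∈ H := by
  refine isClosed_property (PadicInt.denseRange_intCast (p := p))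
    (p := fun c : ℤ_[p] => (c : ℚ_[p]) • x ∈ (H : Set E))
    (H.isClosed'.preimage (f := fun c : ℤ_[p] => (c : ℚ_[p]) • x) (by fun_prop)) (fun k => ?_) c
  rw [PadicInt.coe_intCast, Int.cast_smul_eq_zsmul]
  exact zsmul_mem hx k

theorem mem_of_norm_le (hE : Module.finrank ℚ_[p] E = 1) (H : ClosedAddSubgroup E) {x y : E}
    (hx : x ∈ H) (hyx : ‖y‖ ≤ ‖x‖) : y ∈ H := by
  by_cases h0 : x = 0
  · have : y = 0 := by simpa [h0] using hyx
    exact this ▸ zero_mem H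
  obtain ⟨c, rfl⟩ := exists_smul_eq_of_finrank_eq_one hE h0 y
  rw [norm_smul] at hyx
  have hc : ‖c‖ ≤ 1 := le_of_mul_le_mul_right (by rwa [one_mul]) (norm_pos_iff.2 h0)
  exact padicInt_smul_mem H ⟨c, hc⟩ hx

/-- Ratios of nonzero norms are integral powers of `p`. This gap is what isolates the balls. -/
theorem prime_mul_norm_le (hE : Module.finrank ℚ_[p] E = 1) {x y : E} (hxy : ‖x‖ < ‖y‖) :
    p * ‖x‖ ≤ ‖y‖ := by
  have hp : (1 : ℝ) < p := mod_cast (Fact.out : p.Prime).one_lt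
  by_cases h0 : x = 0
  · simp [h0]
  obtain ⟨c, rfl⟩ := exists_smul_eq_of_finrank_eq_one hE h0 y
  rw [norm_smul] at hxy ⊢
  have hc : 1 < ‖c‖ := by
    by_contra! h
    exact hxy.not_ge (mul_le_of_le_one_left (norm_nonneg x) h)
  refine mul_le_mul_of_nonneg_right ?_ (norm_nonneg x)
  have hc0 : c ≠ 0 := by
    rintro rfl
    norm_num at hc
  rw [Padic.norm_eq_zpow_neg_valuation hc0] at hc ⊢
  rw [one_lt_zpow_iff_right₀ hp] at hc
  exact (zpow_one (p : ℝ)).symm.le.trans (zpow_le_zpow_right₀ hp.le hc)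

/-! ### Balls in the Chabauty space -/

section Ball

variable [IsUltrametricDist E]

/-- The closed subgroup of vectors of norm at most `‖y‖`. -/
def normBall (y : E) : ClosedAddSubgroup E where
  carrier := {x | ‖x‖ ≤ ‖y‖}
  zero_mem' := by simp
  add_mem' ha hb := (IsUltrametricDist.norm_add_le_max _ _).trans (max_le ha hb)
  neg_mem' ha := (norm_neg _).trans_le ha
  isClosed' := isClosed_le continuous_norm continuous_const

theorem mem_normBall {x y : E} : x ∈ normBall y ↔ ‖x‖ ≤ ‖y‖ := Iff.rfl

theorem normBall_congr {x y : E} (h : ‖x‖ = ‖y‖) : normBall x = normBall y :=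
  SetLike.ext fun z => by rw [mem_normBall, mem_normBall, h]

/-- A proper closed subgroup is bounded, since it contains every vector no longer than one of its
members. It is therefore compact, and an element of maximal norm gives the radius. -/
theorem eq_normBall_or_eq_top (hE : Module.finrank ℚ_[p] E = 1) (H : ClosedAddSubgroup E) :
    (∃ y, H = normBall y) ∨ H = ⟨⊤, isClosed_univ⟩ := by
  by_cases hH : ∀ x, x ∈ H
  · exact Or.inr (SetLike.ext fun x => ⟨fun _ => trivial, fun _ => hH x⟩)
  push Not at hH
  obtain ⟨x, hx⟩ := hH
  have hlt : ∀ z ∈ H, ‖z‖ ≤ ‖x‖ := fun z hz => by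
    by_contra! h
    exact hx (mem_of_norm_le hE H hz h.le)
  have : FiniteDimensional ℚ_[p] E := Module.finite_of_finrank_pos (by lia)
  have : ProperSpace E := FiniteDimensional.proper ℚ_[p] E
  have hc : IsCompact (H : Set E) := (isCompact_closedBall (0 : E) ‖x‖).of_isClosed_subset
    H.isClosed' fun z hz => mem_closedBall_zero_iff.2 (hlt z hz)
  obtain ⟨y, hy, hmax⟩ := hc.exists_isMaxOn ⟨0, zero_mem H⟩ continuous_norm.continuousOn
  exact Or.inl ⟨y, SetLike.ext fun z => ⟨fun hz => hmax hz, fun hz => mem_of_norm_le hE H hy hz⟩⟩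

/-- Two subbasic conditions suffice: missing `p⁻¹ • y`, whose norm is the next possible one, bounds
the radius above; meeting the open ball of radius `‖y‖` about `y` bounds it below, by the
ultrametric inequality. -/
theorem isOpen_singleton_normBall (hE : Module.finrank ℚ_[p] E = 1) {y : E} (hy : y ≠ 0) :
    IsOpen {normBall y} := by
  have hy0 : 0 < ‖y‖ := norm_pos_iff.2 hy
  have hp : (1 : ℝ) < p := mod_cast (Fact.out : p.Prime).one_lt
  have hnorm : ‖(p : ℚ_[p])⁻¹ • y‖ = p * ‖y‖ := by
    rw [norm_smul, norm_inv, Padic.norm_p, inv_inv]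
  have heq : ({normBall y} : Set (ClosedAddSubgroup E)) =
      {H : ClosedAddSubgroup E | (H : Set E) ∩ {(p : ℚ_[p])⁻¹ • y} = ∅} ∩
      {H : ClosedAddSubgroup E | ((H : Set E) ∩ Metric.ball y ‖y‖).Nonempty} := by
    ext H
    simp only [Set.mem_singleton_iff, Set.mem_inter_iff, Set.mem_ofPred_eq,
      Set.inter_singleton_eq_empty, SetLike.mem_coe]
    constructor
    · rintro rfl
      refine ⟨?_, y, mem_normBall.2 le_rfl, Metric.mem_ball_self hy0⟩
      rw [mem_normBall, hnorm, not_le]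
      exact lt_mul_of_one_lt_left hy0 hp
    · rintro ⟨h1, z, hz, hzy⟩
      rw [mem_ball_iff_norm] at hzy
      have hzn : ‖y‖ ≤ ‖z‖ := by
        have := IsUltrametricDist.norm_add_le_max z (y - z)
        rw [add_sub_cancel, norm_sub_rev y z] at this
        exact (le_max_iff.1 this).resolve_right hzy.not_ge
      refine SetLike.ext fun x => ⟨fun hx => ?_, fun hx => mem_of_norm_le hE H hz (hx.trans hzn)⟩
      rw [mem_normBall]
      by_contra! h
      exact h1 (mem_of_norm_le hE H hx (hnorm.trans_le (prime_mul_norm_le hE h)))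
  rw [heq]
  exact (TopologicalSpace.isOpen_generateFrom_of_mem (Or.inl ⟨_, isCompact_singleton, rfl⟩)).inter
    (TopologicalSpace.isOpen_generateFrom_of_mem (Or.inr ⟨_, Metric.isOpen_ball, rfl⟩))

theorem tendsto_normBall_zero : Tendsto (normBall : E → _) (𝓝 0) (𝓝 (normBall 0)) := by
  refine TopologicalSpace.tendsto_nhds_generateFrom_iff.2 ?_
  rintro O (⟨K, hK, rfl⟩ | ⟨U, hU, rfl⟩) hO
  · have h0 : (0 : E) ∈ Kᶜ := fun h => Set.eq_empty_iff_forall_notMem.1 hO 0 ⟨zero_mem _, h⟩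
    obtain ⟨ε, hε, hb⟩ := Metric.isOpen_iff.1 hK.isClosed.isOpen_compl 0 h0
    filter_upwards [Metric.ball_mem_nhds (0 : E) hε] with y hy
    refine Set.eq_empty_of_forall_notMem ?_
    rintro z ⟨hz, hzK⟩
    rw [mem_ball_zero_iff] at hy
    exact hb (mem_ball_zero_iff.2 (lt_of_le_of_lt hz hy)) hzK
  · obtain ⟨z, hz, hzU⟩ := hO
    obtain rfl : z = 0 := by simpa [mem_normBall] using hz
    exact Eventually.of_forall fun y => ⟨0, zero_mem _, hzU⟩

theorem actionHomeomorph_zpow_normBall {T : E ≃ₜ+ E} {a : ℚ_[p]} (ha : a ≠ 0)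
    (hT : ∀ x, T x = a • x) (k : ℤ) (y : E) :
    (actionHomeomorph T ^ k) (normBall y) = normBall (a ^ k • y) := by
  refine SetLike.coe_injective ?_
  rw [coe_actionHomeomorph_zpow]
  ext z
  simp only [Set.mem_image, SetLike.mem_coe, mem_normBall,
    toHomeomorph_zpow_apply_of_smul ha hT, norm_smul]
  have hk : a ^ k ≠ 0 := zpow_ne_zero k ha
  have hk0 : 0 < ‖a ^ k‖ := norm_pos_iff.2 hk
  constructor
  · rintro ⟨x, hx, rfl⟩
    rw [norm_smul]
    exact mul_le_mul_of_nonneg_left hx hk0.le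
  · intro hz
    refine ⟨(a ^ k)⁻¹ • z, ?_, smul_inv_smul₀ hk z⟩
    rwa [norm_smul, norm_inv, inv_mul_le_iff₀ hk0]

theorem isExpansiveHomeomorph_iff_norm_ne_one (hE : Module.finrank ℚ_[p] E = 1)
    (d : MetricSpace (ClosedAddSubgroup E))
    (hd : d.toUniformSpace.toTopologicalSpace = chabautyTopology E) {T : E ≃ₜ+ E} {a : ℚ_[p]}
    (ha : a ≠ 0) (hT : ∀ x, T x = a • x) :
    IsExpansiveHomeomorph d (actionHomeomorph T) ↔ ‖a‖ ≠ 1 := by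
  have hp : (1 : ℝ) < p := mod_cast (Fact.out : p.Prime).one_lt
  have hp0 : (p : ℚ_[p]) ≠ 0 := mod_cast (Fact.out : p.Prime).ne_zero
  have : Nontrivial E := Module.nontrivial_of_finrank_pos (R := ℚ_[p]) (by lia)
  obtain ⟨e, he⟩ := exists_ne (0 : E)
  have he0 : 0 < ‖e‖ := norm_pos_iff.2 he
  constructor
  · rintro ⟨δ, hδ, h⟩ ha1
    have hev := tendsto_normBall_zero.eventually
      (eventually_dist_lt_of_compatible d hd (normBall (0 : E)) hδ)
    obtain ⟨ε, hε, hb⟩ := Metric.eventually_nhds_iff_ball.1 hev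
    obtain ⟨c, hc0, hc⟩ := NormedField.exists_norm_lt ℚ_[p] (div_pos hε he0)
    have hce : ‖c • e‖ < ε := by rwa [norm_smul, ← lt_div_iff₀ he0]
    have hne : normBall (0 : E) ≠ normBall (c • e) := by
      intro heq
      have hmem : c • e ∈ normBall (0 : E) := by
        rw [heq]
        exact mem_normBall.2 le_rfl
      rw [mem_normBall, norm_zero, norm_smul] at hmem
      exact hmem.not_gt (mul_pos hc0 he0)
    obtain ⟨k, hk⟩ := h _ _ hne
    have hfix (y : E) : (actionHomeomorph T ^ k) (normBall y) = normBall y := by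
      rw [actionHomeomorph_zpow_normBall ha hT]
      exact normBall_congr (by rw [norm_smul, norm_zpow, ha1, one_zpow, one_mul])
    rw [hfix, hfix] at hk
    exact hk.not_gt (hb _ (mem_ball_zero_iff.2 hce))
  · intro ha1
    set m := a.valuation with hm
    have ham : ‖a‖ = (p : ℝ) ^ (-m) := Padic.norm_eq_zpow_neg_valuation ha
    have hm0 : m ≠ 0 := by
      intro h
      rw [h, neg_zero, zpow_zero] at ham
      exact ha1 ham
    -- `T` shifts valuations by `m`, so residues modulo `m` index the orbits of balls of positive
    -- radius.
    have horbit : ∀ y : E, y ≠ 0 → ∃ k : ℤ, ∃ i ∈ Finset.range m.natAbs,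
        (actionHomeomorph T ^ k) (normBall y) = normBall ((p : ℚ_[p]) ^ i • e) := by
      intro y hy
      obtain ⟨c, rfl⟩ := exists_smul_eq_of_finrank_eq_one hE he y
      have hc : c ≠ 0 := by
        rintro rfl
        exact hy (zero_smul _ _)
      have hj := Int.emod_nonneg c.valuation hm0
      refine ⟨-(c.valuation / m), (c.valuation % m).toNat, ?_, ?_⟩
      · have := Int.emod_lt c.valuation hm0
        rw [Finset.mem_range]
        lia
      · rw [actionHomeomorph_zpow_normBall ha hT]
        refine normBall_congr ?_
        rw [norm_smul, norm_smul, norm_smul, norm_zpow, ham,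
          Padic.norm_eq_zpow_neg_valuation hc, Padic.norm_p_pow, ← zpow_mul, ← mul_assoc,
          ← zpow_add₀ (by positivity), Int.toNat_of_nonneg hj]
        congr 2
        have := Int.emod_add_mul_ediv c.valuation m
        linarith
    refine IsExpansiveHomeomorph.of_isOpen_singletons d hd _ (Finset.range m.natAbs)
      (fun i => normBall ((p : ℚ_[p]) ^ i • e))
      (fun i _ => isOpen_singleton_normBall hE (smul_ne_zero (pow_ne_zero _ hp0) he))
      (normBall 0) ⟨⊤, isClosed_univ⟩ ?_ ?_
    · intro h
      have : e ∈ normBall (0 : E) := by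
        rw [h]
        trivial
      exact he (by simpa [mem_normBall] using this)
    · intro x y hxy
      rcases eq_normBall_or_eq_top hE x with ⟨u, rfl⟩ | rfl <;>
      rcases eq_normBall_or_eq_top hE y with ⟨v, rfl⟩ | rfl
      · by_cases hu : u = 0
        · have hv : v ≠ 0 := by
            rintro rfl
            exact hxy (by rw [hu])
          obtain ⟨k, i, hi, h⟩ := horbit v hv
          exact Or.inl ⟨k, i, hi, Or.inr h⟩
        · obtain ⟨k, i, hi, h⟩ := horbit u hu
          exact Or.inl ⟨k, i, hi, Or.inl h⟩
      · by_cases hu : u = 0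
        · exact Or.inr (Or.inl ⟨by rw [hu], rfl⟩)
        · obtain ⟨k, i, hi, h⟩ := horbit u hu
          exact Or.inl ⟨k, i, hi, Or.inl h⟩
      · by_cases hv : v = 0
        · exact Or.inr (Or.inr ⟨rfl, by rw [hv]⟩)
        · obtain ⟨k, i, hi, h⟩ := horbit v hv
          exact Or.inl ⟨k, i, hi, Or.inr h⟩
      · exact absurd rfl hxy

end Ball

end ClosedAddSubgroup

/-! ### Expansive scalar automorphisms -/

/-- The intersection consists of the points whose whole orbit lies in `U`. If `‖a‖ = 1`, orbits have
constant norm and short vectors never leave; otherwise each nonzero orbit is unbounded in one time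
direction and leaves the unit ball. -/
theorem isExpansiveAut_iff_norm_ne_one {𝕜 E : Type*} [NontriviallyNormedField 𝕜]
    [NormedAddCommGroup E] [NormedSpace 𝕜 E] [Nontrivial E] {T : E ≃ₜ+ E} {a : 𝕜}
    (ha : a ≠ 0) (hT : ∀ x, T x = a • x) : IsExpansiveAut T ↔ ‖a‖ ≠ 1 := by
  have hk := ClosedAddSubgroup.toHomeomorph_zpow_apply_of_smul ha hT
  have himage (U : Set E) (x : E) : x ∈ ⋂ k : ℤ, (T.toHomeomorph ^ k) '' U ↔
      ∀ k : ℤ, a ^ k • x ∈ U := by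
    simp only [Set.mem_iInter, Set.mem_image, hk]
    constructor
    · intro h k
      obtain ⟨u, hu, rfl⟩ := h (-k)
      rwa [zpow_neg, smul_inv_smul₀ (zpow_ne_zero k ha)]
    · intro h k
      refine ⟨_, h (-k), ?_⟩
      rw [zpow_neg, smul_inv_smul₀ (zpow_ne_zero k ha)]
  constructor
  · rintro ⟨U, hU, hUT⟩ ha1
    obtain ⟨ε, hε, hb⟩ := Metric.mem_nhds_iff.1 hU
    obtain ⟨e, he⟩ := exists_ne (0 : E)
    have he0 : 0 < ‖e‖ := norm_pos_iff.2 he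
    obtain ⟨c, hc0, hc⟩ := NormedField.exists_norm_lt 𝕜 (div_pos hε he0)
    have hmem : c • e ∈ ⋂ k : ℤ, (T.toHomeomorph ^ k) '' U := by
      refine (himage U _).2 fun k => hb ?_
      rwa [mem_ball_zero_iff, norm_smul, norm_zpow, ha1, one_zpow, one_mul, norm_smul,
        ← lt_div_iff₀ he0]
    rw [hUT, Set.mem_singleton_iff] at hmem
    exact smul_ne_zero (norm_pos_iff.1 hc0) he hmem
  · intro ha1
    refine ⟨Metric.closedBall 0 1, Metric.closedBall_mem_nhds _ one_pos, ?_⟩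
    refine Set.eq_singleton_iff_unique_mem.2 ⟨(himage _ _).2 fun k => by simp, fun x hx => ?_⟩
    rw [himage] at hx
    by_contra hx0
    have hx1 : 0 < ‖x‖ := norm_pos_iff.2 hx0
    have hbound (b : ℝ) (hb : 1 < b) (h : ∀ n : ℕ, b ^ n * ‖x‖ ≤ 1) : False := by
      obtain ⟨n, hn⟩ := pow_unbounded_of_one_lt (1 / ‖x‖) hb
      exact (h n).not_gt (by rwa [div_lt_iff₀ hx1] at hn)
    have hz (k : ℤ) : ‖a‖ ^ k * ‖x‖ ≤ 1 := by
      have := hx k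
      rwa [mem_closedBall_zero_iff, norm_smul, norm_zpow] at this
    rcases ha1.lt_or_gt with h | h
    · refine hbound ‖a‖⁻¹ ((one_lt_inv₀ (norm_pos_iff.2 ha)).2 h) fun n => ?_
      simpa using hz (-n)
    · exact hbound ‖a‖ h fun n => by simpa using hz n

theorem Padic.norm_ne_one_iff {p : ℕ} [Fact p.Prime] {a : ℚ_[p]} (ha : a ≠ 0) :
    ‖a‖ ≠ 1 ↔ ∃ m : ℤ, m ≠ 0 ∧ ∃ z : ℤ_[p]ˣ, a = (p : ℚ_[p]) ^ m * ((z : ℤ_[p]) : ℚ_[p]) := by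
  have hp : (1 : ℝ) < p := mod_cast (Fact.out : p.Prime).one_lt
  have hp0 : (p : ℚ_[p]) ≠ 0 := mod_cast (Fact.out : p.Prime).ne_zero
  constructor
  · intro h
    have hu : ‖(p : ℚ_[p]) ^ (-a.valuation) * a‖ = 1 := by
      rw [norm_mul, Padic.norm_p_zpow, Padic.norm_eq_zpow_neg_valuation ha,
        ← zpow_add₀ (by positivity)]
      simp
    refine ⟨a.valuation, fun h0 => h ?_, PadicInt.mkUnits hu, ?_⟩
    · rw [Padic.norm_eq_zpow_neg_valuation ha, h0, neg_zero, zpow_zero]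
    · rw [PadicInt.mkUnits_eq, ← mul_assoc, ← zpow_add₀ hp0]
      simp
  · rintro ⟨m, hm, z, rfl⟩ h
    rw [norm_mul, Padic.norm_p_zpow, PadicInt.padic_norm_e_of_padicInt, PadicInt.norm_units,
      mul_one, zpow_eq_one_iff_right₀ (by positivity) hp.ne'] at h
    exact hm (neg_eq_zero.1 h)

/-! ### Assembly -/

theorem proposition4p3 (p : ℕ) [Fact p.Prime] (n : ℕ)
    (d : MetricSpace (ClosedAddSubgroup (Fin n → ℚ_[p])))
    (hd : d.toUniformSpace.toTopologicalSpace = chabautyTopology (Fin n → ℚ_[p])) :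
    (n = 1 → ∀ T : GL (Fin n) ℚ_[p],
      (IsExpansiveHomeomorph d (ClosedAddSubgroup.actionHomeomorph T.toAut) ↔
        IsExpansiveAut T.toAut) ∧
      (IsExpansiveAut T.toAut ↔
        ∃ m : ℤ, m ≠ 0 ∧ ∃ z : ℤ_[p]ˣ, ∀ x : Fin n → ℚ_[p],
          T.toAut x = ((p : ℚ_[p]) ^ m * ((z : ℤ_[p]) : ℚ_[p])) • x)) ∧
    (2 ≤ n →
      (∀ T : GL (Fin n) ℚ_[p],
        ¬ IsExpansiveHomeomorph d (ClosedAddSubgroup.actionHomeomorph T.toAut)) ∧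
      (∀ T : (Fin n → ℚ_[p]) ≃ₜ+ (Fin n → ℚ_[p]),
        ¬ IsExpansiveHomeomorph d (ClosedAddSubgroup.actionHomeomorph T))) := by
  constructor
  · rintro rfl T
    obtain ⟨a, hT⟩ : ∃ a : ℚ_[p], ∀ x, T.toAut x = a • x := by
      refine ⟨T.1 0 0, fun x => funext fun i => ?_⟩
      have : T.toAut x = T.1.mulVec x := rfl
      rw [this, Subsingleton.elim i 0]
      simp [Matrix.mulVec, dotProduct]
    have ha : a ≠ 0 := by
      rintro rfl
      have h1 : T.toAut 1 = T.toAut 0 := by rw [hT, hT, zero_smul, zero_smul]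
      exact one_ne_zero (T.toAut.injective h1)
    have hE : Module.finrank ℚ_[p] (Fin 1 → ℚ_[p]) = 1 := by simp
    have haut := isExpansiveAut_iff_norm_ne_one ha hT
    refine ⟨(ClosedAddSubgroup.isExpansiveHomeomorph_iff_norm_ne_one hE d hd ha hT).trans
      haut.symm, haut.trans ((Padic.norm_ne_one_iff ha).trans ?_)⟩
    refine exists_congr fun m => and_congr_right fun _ => exists_congr fun z => ?_
    constructor
    · rintro rfl x
      exact hT x
    · intro h
      simpa [hT] using congrFun (h 1) 0
  · intro hn
    have key : ∀ T : (Fin n → ℚ_[p]) ≃ₜ+ (Fin n → ℚ_[p]),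
        ¬ IsExpansiveHomeomorph d (ClosedAddSubgroup.actionHomeomorph T) := by
      intro T
      let L : (Fin n → ℚ_[p]) ≃L[ℚ_[p]] (Fin n → ℚ_[p]) :=
        { T with map_smul' := T.map_padic_smul }
      refine ClosedAddSubgroup.not_isExpansiveHomeomorph_of_one_lt_finrank (𝕜 := ℚ_[p]) (L := L)
        d hd ?_ fun x => rfl
      rw [Module.finrank_fin_fun]
      lia
    exact ⟨fun T => key T.toAut, key⟩
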